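/- **Definitions.** Let $G$ be a group. A subset of $G$ is *elementary algebraic* if it has the form $\{x\in G: x^{\varepsilon_1}a_1x^{\varepsilon_2}a_2\cdots a_{n-1}x^{\varepsilon_n}=a_n\}$ with $n\ge 1$, $a_1,\dots,a_n\in G$ and $\varepsilon_1,\dots,\varepsilon_n\in\{-1,1\}$. The *Zariski topology* $\mathfrak Z_G$ is the topology on $G$ whose closed sets are the intersections of finite unions of elementary algebraic sets. The *Markov topology* $\mathfrak M_G$ is the intersection of all Hausdorff group topologies on $G$; its closed sets are the sets that are closed in every Hausdorff group topology on $G$. A subgroup $K$ of $G$ is *Zariski embedded* in $G$ if $\mathfrak Z_K$ is the subspace topology induced on $K$ by $\mathfrak Z_G$, and *Markov embedded* in $G$ if $\mathfrak M_K$ is the subspace topology induced on $K$ by $\mathfrak M_G$. A *metric group topology* is a metrizable group topology. A topology on $G$ *extends* a topology $\mathcal T$ on $K$ if its restriction to $K$ is $\mathcal T$. **Lemma.** Let $N$ be a countable Abelian group that admits a decomposition $N= N_1\times N_2$ into a direct product of two infinite groups $N_1$ and $N_2$. Then there exist a countable group $G'$, a subgroup $H$ of $G'\times G'$, and a metric group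 topology $\mathcal T^*$ on $G^*=H\cap(G'\times\{1\})$ such that: 1. $G^*$ is isomorphic to $N$ and $[H:G^*]=2$; 2. $G^*$ is neither Markov embedded in $H$ nor Zariski embedded in $H$; 3. $\mathcal T^*$ cannot be extended to any Hausdorff group topology on $H$. -/

import Mathlib

universe u v w

namespace MarkovZariski

/-- A subset `S` of a group `G` is elementary algebraic if it is the solution set of an equation
`x ^ ε₁ * a₁ * x ^ ε₂ * a₂ * ⋯ * aₙ₋₁ * x ^ εₙ = aₙ`, where `n > 0`, the `aᵢ` lie in `G`
and the `εᵢ` are `1` or `-1`.  Below `n = m + 1` and the indices start at `0`. -/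
def IsElementaryAlgebraic {G : Type u} [Group G] (S : Set G) : Prop :=
  ∃ (m : ℕ) (a : Fin (m + 1) → G) (ε : Fin (m + 1) → ℤˣ),
    S = {x : G | (List.ofFn fun i : Fin m =>
            x ^ ((ε i.castSucc : ℤˣ) : ℤ) * a i.castSucc).prod
          * x ^ ((ε (Fin.last m) : ℤˣ) : ℤ) = a (Fin.last m)}

/-- The Zariski (verbal) topology of a group: the elementary algebraic sets are a subbase of its
closed sets, so that its closed sets are the intersections of finite unions of elementary
algebraic sets. -/
abbrev zariskiTopology (G : Type u) [Group G] : TopologicalSpace G :=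
  TopologicalSpace.generateFrom {U : Set G | IsElementaryAlgebraic Uᶜ}

/-- A Hausdorff group topology on a group. -/
def IsHausdorffGroupTopology {G : Type u} [Group G] (t : TopologicalSpace G) : Prop :=
  @IsTopologicalGroup G t _ ∧ @T2Space G t

/-- A metric group topology on a group: a group topology that is induced by a metric. -/
def IsMetricGroupTopology {G : Type u} [Group G] (t : TopologicalSpace G) : Prop :=
  @IsTopologicalGroup G t _ ∧ @TopologicalSpace.MetrizableSpace G t

/-- The Markov topology of a group: the intersection of all Hausdorff group topologies, whose
closed sets are the sets that are closed in every Hausdorff group topology.  (In Mathlib's order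
on topologies a coarser topology is larger, so this intersection is the supremum.) -/
abbrev markovTopology (G : Type u) [Group G] : TopologicalSpace G :=
  sSup {t : TopologicalSpace G | IsHausdorffGroupTopology t}

/-- The Zariski topology of `K` is the subspace topology of the Zariski topology of `G`. -/
def ZariskiEmbedded {G : Type u} [Group G] (K : Subgroup G) : Prop :=
  zariskiTopology K = (zariskiTopology G).induced ((↑) : K → G)

/-- The Markov topology of `K` is the subspace topology of the Markov topology of `G`. -/
def MarkovEmbedded {G : Type u} [Group G] (K : Subgroup G) : Prop :=
  markovTopology K = (markovTopology G).induced ((↑) : K → G)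

/-- The topology `s` on `G` extends the topology `t` on the subgroup `K`: the restriction of `s`
to `K` is `t`. -/
def ExtendsTopology {G : Type u} [Group G] (K : Subgroup G) (s : TopologicalSpace G)
    (t : TopologicalSpace K) : Prop :=
  s.induced ((↑) : K → G) = t

/-- For a subgroup `H` of `G₁ × G₂`, the subgroup `H ∩ (G₁ × {1})`, as a subgroup of `H`. -/
def firstFactorPart {G₁ : Type u} {G₂ : Type v} [Group G₁] [Group G₂]
    (H : Subgroup (G₁ × G₂)) : Subgroup H :=
  ((⊤ : Subgroup G₁).prod (⊥ : Subgroup G₂)).subgroupOf H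

end MarkovZariski

namespace MarkovZariski

open scoped Topology Pointwise

/-! ### Sparse sequences and metrizable group topologies in which they tend to zero. -/

section Sparse

variable {A : Type*} [AddCommGroup A]

/-! It suffices to find an automorphism σ of order 2 of N and a metrizable group topology on N in
which Fix σ is not closed. For L = N ⋊ ⟨σ⟩, let H be the graph in L × L of the retraction L → ⟨σ⟩;
then H ∩ (L × 1) is a copy of N. The centralizer of σ in H is elementary algebraic, so it is closed
in the Zariski topology, the Markov topology and every Hausdorff group topology of H, yet its trace
on N is Fix σ (`not_embedded_of_not_isClosed`).

Write N additively and σ = 1 + r with r² + 2r = 0, so that Fix σ = ker r. The topology makes a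
sequence from a subgroup D ≤ ker r converge to some x ∉ ker r: `exists_sparse_seq` picks t_k ∈ D - x
so sparse that t_k → 0 in a metrizable group topology. This works if nD = 0, nx = 0 and cD is
infinite unless n ∣ c.

Let n generate the ideal of all c with cN finite. If n ≠ 0, choose r with finite image and D = ker r
∩ N[n]: a transvection a ↦ a + φ(a)e for even n, inversion of a finite cyclic summand for odd n. If
n = 0, invert one of the two given summands and let D be the other, or use a transvection when one
of them has exponent 2. -/

theorem mem_torsionBy {c : ℤ} {a : A} : a ∈ AddSubgroup.torsionBy A c ↔ c • a = 0 :=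
  Submodule.mem_torsionBy_iff c a

/-- If `D` has exponent dividing `n` and `c • D` is infinite whenever `n ∤ c`, then the coset `D - x`
contains an element whose small nonzero multiples avoid a given finite set. -/
theorem exists_sub_zsmul_avoiding {D : AddSubgroup A} {x : A} {n : ℤ}
    (hD : ∀ d ∈ D, n • d = 0) (hx : n • x = 0)
    (hind : ∀ c : ℤ, ¬ n ∣ c → (AddSubgroup.torsionBy A c).relIndex D = 0)
    (E : Finset A) (C : Finset ℤ) :
    ∃ t : A, (∃ d ∈ D, t = d - x) ∧ ∀ c ∈ C, c • t ∈ E → c • t = 0 := by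
  classical
  by_contra! hcon
  let s : Finset (ℤ × A) := (C.filter fun c => ¬ n ∣ c) ×ˢ E
  let H : ℤ × A → AddSubgroup D := fun i => (AddSubgroup.torsionBy A i.1).addSubgroupOf D
  let g : ℤ × A → D := fun i =>
    if h : ∃ d : D, i.1 • ((d : A) - x) = i.2 then h.choose else 0
  have hg : ∀ i : ℤ × A, (∃ d : D, i.1 • ((d : A) - x) = i.2) → i.1 • ((g i : A) - x) = i.2 := by
    intro i h
    simp only [g, dif_pos h]
    exact h.choose_spec
  -- For fixed c and value v, the solutions d of c(d - x) = v form a coset of D[c]. If every choice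
  -- failed, finitely many such cosets with n ∤ c would cover D, and by B. H. Neumann's lemma one
  -- D[c] would have finite index.
  have hcov : ⋃ i ∈ s, g i +ᵥ (H i : Set D) = Set.univ := by
    refine Set.eq_univ_of_forall fun d => ?_
    obtain ⟨c, hc, hE, h0⟩ := hcon (d - x) ⟨d, d.2, rfl⟩
    have hnc : ¬ n ∣ c := by
      rintro ⟨k, rfl⟩
      exact h0 (by rw [mul_comm, mul_smul, smul_sub, hD d d.2, hx, sub_zero, smul_zero])
    simp only [Set.mem_iUnion]
    refine ⟨(c, c • ((d : A) - x)), by simp [s, hc, hnc, hE], ?_⟩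
    have := hg (c, c • ((d : A) - x)) ⟨d, rfl⟩
    rw [mem_leftAddCoset_iff]
    generalize g (c, c • ((d : A) - x)) = z at this ⊢
    simp only [H, SetLike.mem_coe, AddSubgroup.mem_addSubgroupOf, mem_torsionBy]
    simp only [smul_sub, sub_left_inj] at this
    push_cast
    rw [smul_add, smul_neg, this]
    simp
  obtain ⟨i, hi, hfin⟩ := AddSubgroup.exists_finiteIndex_of_leftCoset_cover hcov
  have hi' : ¬ n ∣ i.1 := by
    simp only [s, Finset.mem_product, Finset.mem_filter] at hi
    exact hi.1.2
  exact hfin.index_ne_zero (hind _ hi')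

/-- A sequence in `A` all of whose small nonzero combinations run away. -/
theorem exists_sparse_seq [Countable A] (P : A → Prop)
    (hP : ∀ (E : Finset A) (C : Finset ℤ), ∃ t, P t ∧ ∀ c ∈ C, c • t ∈ E → c • t = 0) :
    ∃ t : ℕ → A, (∀ k, P (t k)) ∧ ∀ a : A, a ≠ 0 → ∃ m : ℕ, ∀ c : ℕ → ℤ,
      (∀ k, 2 ^ m * |c k| < 2 ^ k) → ∀ M, a ≠ ∑ k ∈ Finset.range M, c k • t k := by
  classical
  obtain ⟨g, hg⟩ := exists_surjective_nat A
  choose pick hpick havoid using hP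
  let I : ℕ → Finset ℤ := fun k => Finset.Icc (-2 ^ k) (2 ^ k)
  -- `F k` collects the combinations of the first k terms. The k-th term is chosen so that its small
  -- multiples avoid every nonzero g j - u with j ≤ k and u ∈ `F k`.
  let T : ℕ → Finset A → A := fun k F =>
    pick (Finset.image₂ (fun j u => g j - u) (Finset.range (k + 1)) F) (I k)
  let F : ℕ → Finset A := fun k => Nat.rec {0}
    (fun k F => Finset.image₂ (fun u c => u + c • T k F) F (I k)) k
  have hF : ∀ k, F (k + 1) = Finset.image₂ (fun u c => u + c • T k (F k)) (F k) (I k) :=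
    fun _ => rfl
  refine ⟨fun k => T k (F k), fun k => hpick _ _, fun a ha => ?_⟩
  obtain ⟨m, rfl⟩ := hg a
  -- The index m of a in the enumeration serves twice: smallness forces c k = 0 for k < m, and from
  -- step m on the choice of terms takes a into account.
  refine ⟨m, fun c hc => ?_⟩
  have hI : ∀ k, c k ∈ I k := by
    intro k
    have h1 : |c k| ≤ 2 ^ m * |c k| :=
      le_mul_of_one_le_left (abs_nonneg _) (one_le_pow₀ (by norm_num))
    exact Finset.mem_Icc.2 (abs_le.1 (h1.trans (hc k).le))
  have hsum : ∀ M, ∑ k ∈ Finset.range M, c k • T k (F k) ∈ F M := by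
    intro M
    induction M with
    | zero => simp [F]
    | succ M ih =>
      rw [Finset.sum_range_succ, hF]
      exact Finset.mem_image₂_of_mem ih (hI M)
  intro M
  induction M with
  | zero => simpa using ha
  | succ M ih =>
    rw [Finset.sum_range_succ]
    rcases le_or_gt m M with hmM | hmM
    · intro h
      have h0 : c M • T M (F M) = 0 := by
        refine havoid _ _ _ (hI M) ?_
        rw [Finset.mem_image₂]
        exact ⟨m, Finset.mem_range.2 (by omega), _, hsum M, by rw [h]; simp [T]⟩
      rw [h0, add_zero] at h
      exact ih h
    · have h0 : c M = 0 := by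
        by_contra hne
        have h1 : (1 : ℤ) ≤ |c M| := Int.one_le_abs hne
        have h2 : (2 : ℤ) ^ M ≤ 2 ^ m := pow_le_pow_right₀ (by norm_num) hmM.le
        have h3 : (2 : ℤ) ^ m ≤ 2 ^ m * |c M| := le_mul_of_one_le_right (by positivity) h1
        exact absurd (hc M) (not_lt.2 (h2.trans h3))
      rwa [h0, zero_smul, add_zero]

/-- The combinations of the `t k` whose coefficients are small relative to `2 ^ (k - m)`. -/
def smallCombinations (t : ℕ → A) (m : ℕ) : Set A :=
  {a | ∃ c : ℕ →₀ ℤ, (∀ k, 2 ^ m * |c k| < 2 ^ k) ∧ a = Finsupp.linearCombination ℤ t c}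

theorem smallCombinations_antitone (t : ℕ → A) : Antitone (smallCombinations t) := by
  rintro m m' h a ⟨c, hc, rfl⟩
  refine ⟨c, fun k => lt_of_le_of_lt ?_ (hc k), rfl⟩
  exact mul_le_mul_of_nonneg_right (pow_le_pow_right₀ (by norm_num) h) (abs_nonneg _)

/-- The group topology whose neighbourhoods of `0` are the sets of small combinations of `t`. -/
@[reducible] def combinationBasis (t : ℕ → A) : AddGroupFilterBasis A :=
  addGroupFilterBasisOfComm (Set.range (smallCombinations t)) (Set.range_nonempty _)
    (by
      rintro _ _ ⟨m, rfl⟩ ⟨m', rfl⟩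
      exact ⟨_, ⟨max m m', rfl⟩, Set.subset_inter (smallCombinations_antitone t (le_max_left _ _))
        (smallCombinations_antitone t (le_max_right _ _))⟩)
    (by
      rintro _ ⟨m, rfl⟩
      exact ⟨0, by simp, by simp⟩)
    (by
      rintro _ ⟨m, rfl⟩
      -- Raising m by one halves the bound on coefficients, so two such combinations add up to one
      -- at level m.
      refine ⟨_, ⟨m + 1, rfl⟩, ?_⟩
      rintro _ ⟨_, ⟨c, hc, rfl⟩, _, ⟨c', hc', rfl⟩, rfl⟩
      refine ⟨c + c', fun k => ?_, by simp⟩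
      have h1 := hc k
      have h2 := hc' k
      have h3 : 2 ^ m * |(c + c') k| ≤ 2 ^ m * (|c k| + |c' k|) :=
        mul_le_mul_of_nonneg_left (abs_add_le _ _) (by positivity)
      rw [pow_succ] at h1 h2
      linarith)
    (by
      rintro _ ⟨m, rfl⟩
      refine ⟨_, ⟨m, rfl⟩, ?_⟩
      rintro _ ⟨c, hc, rfl⟩
      exact ⟨-c, by simpa using hc, by simp⟩)

/-- The sparseness hypothesis says exactly that each a ≠ 0 misses a basic neighbourhood of 0, so the
topology is Hausdorff; its countable base at 0 makes it metrizable. For k > m the term t k is itself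
a small combination at level m. -/
theorem exists_metrizable_tendsto [Countable A] (t : ℕ → A)
    (ht : ∀ a : A, a ≠ 0 → ∃ m : ℕ, ∀ c : ℕ → ℤ,
      (∀ k, 2 ^ m * |c k| < 2 ^ k) → ∀ M, a ≠ ∑ k ∈ Finset.range M, c k • t k) :
    ∃ _ : TopologicalSpace A, IsTopologicalAddGroup A ∧ TopologicalSpace.MetrizableSpace A ∧
      Filter.Tendsto t Filter.atTop (𝓝 0) := by
  let B := combinationBasis t
  let : TopologicalSpace A := B.topology
  have hgrp : IsTopologicalAddGroup A := B.isTopologicalAddGroup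
  have hB : (𝓝 (0 : A)).HasBasis (fun _ : ℕ => True) (smallCombinations t) := by
    refine B.nhds_zero_hasBasis.to_hasBasis ?_ ?_
    · rintro _ ⟨m, rfl⟩
      exact ⟨m, trivial, le_rfl⟩
    · intro m _
      exact ⟨_, ⟨m, rfl⟩, le_rfl⟩
  refine ⟨_, hgrp, ?_, ?_⟩
  · have : T2Space A := by
      refine IsTopologicalAddGroup.t2Space_of_zero_sep fun a ha => ?_
      obtain ⟨m, hm⟩ := ht a ha
      refine ⟨_, hB.mem_of_mem (i := m) trivial, ?_⟩
      rintro ⟨c, hc, h⟩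
      obtain ⟨M, hM⟩ := c.support.exists_nat_subset_range
      refine hm c hc M ?_
      rw [h, Finsupp.linearCombination_apply, Finsupp.sum_of_support_subset _ hM _ (by simp)]
    have : (𝓝 (0 : A)).IsCountablyGenerated := hB.isCountablyGenerated
    let := IsTopologicalAddGroup.rightUniformSpace A
    have : IsUniformAddGroup A := isUniformAddGroup_of_addCommGroup
    have : (uniformity A).IsCountablyGenerated :=
      IsUniformAddGroup.uniformity_countably_generated
    exact UniformSpace.metrizableSpace
  · refine hB.tendsto_right_iff.2 fun m _ => ?_
    filter_upwards [Filter.eventually_gt_atTop m] with k hk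
    refine ⟨Finsupp.single k 1, fun j => ?_, by simp⟩
    rcases eq_or_ne k j with rfl | hkj
    · simpa using pow_lt_pow_right₀ (by norm_num : (1 : ℤ) < 2) hk
    · simp [Finsupp.single_eq_of_ne' hkj]

/-- A subgroup `S ≥ D` of a countable abelian group is not closed in some metrizable group topology
if some `x ∉ S` satisfies `n • x = 0`, `n • D = 0` and `c • D` is infinite whenever `n ∤ c`. -/
theorem exists_metrizable_not_isClosed [Countable A] {D S : AddSubgroup A} {x : A} {n : ℤ}
    (hDS : D ≤ S) (hxS : x ∉ S) (hD : ∀ d ∈ D, n • d = 0) (hx : n • x = 0)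
    (hind : ∀ c : ℤ, ¬ n ∣ c → (AddSubgroup.torsionBy A c).relIndex D = 0) :
    ∃ _ : TopologicalSpace A, IsTopologicalAddGroup A ∧ TopologicalSpace.MetrizableSpace A ∧
      ¬ IsClosed (S : Set A) := by
  obtain ⟨t, htP, ht⟩ := exists_sparse_seq _ (exists_sub_zsmul_avoiding hD hx hind)
  obtain ⟨_, hgrp, hmet, hlim⟩ := exists_metrizable_tendsto t ht
  refine ⟨_, hgrp, hmet, fun hcl => hxS ?_⟩
  have h : Filter.Tendsto (fun k => t k + x) Filter.atTop (𝓝 x) := by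
    simpa using hlim.add_const x
  refine hcl.mem_of_tendsto h (Filter.Eventually.of_forall fun k => ?_)
  obtain ⟨d, hd, h⟩ := htP k
  rw [h, sub_add_cancel]
  exact hDS hd

end Sparse

/-! ### Choice of the involution 1 + r according to the essential exponent. -/

section Involution

variable {A : Type*} [AddCommGroup A]

/-- Split a = πa + (a - πa). This shows that both summands cannot be bounded up to finite index when
the essential exponent is 0. -/
theorem torsionBy_mul_ge_comap (π : A →+ A) (c c' : ℤ) :
    (AddSubgroup.torsionBy A c).comap π ⊓
      (AddSubgroup.torsionBy A c').comap (AddMonoidHom.id A - π) ≤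
      AddSubgroup.torsionBy A (c * c') := by
  rintro a ⟨h1, h2⟩
  have h1 : c • π a = 0 := mem_torsionBy.1 h1
  have h2 : c' • (a - π a) = 0 := mem_torsionBy.1 h2
  rw [mem_torsionBy]
  have h3 : (c * c') • a = c' • c • π a + c • c' • (a - π a) := by
    rw [smul_sub, smul_sub, mul_smul, smul_comm c' c]
    abel
  rw [h3, h1, h2, smul_zero, smul_zero, add_zero]

theorem torsionBy_le_of_dvd {c c' : ℤ} (h : c ∣ c') :
    AddSubgroup.torsionBy A c ≤ AddSubgroup.torsionBy A c' := by
  obtain ⟨k, rfl⟩ := h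
  intro a ha
  rw [mem_torsionBy] at ha ⊢
  rw [mul_comm, mul_smul, ha, smul_zero]

theorem index_eq_zero_of_le {H K : AddSubgroup A} (h : H ≤ K) (hK : K.index = 0) : H.index = 0 :=
  eq_zero_of_zero_dvd (hK ▸ AddSubgroup.index_dvd_of_le h)

/-- The integers `c` for which `c • A` is finite are the multiples of one of them. -/
theorem exists_essential_exponent (A : Type*) [AddCommGroup A] :
    ∃ n : ℤ, ∀ c : ℤ, (AddSubgroup.torsionBy A c).index ≠ 0 ↔ n ∣ c := by
  let I : AddSubgroup ℤ :=
    { carrier := {c | (AddSubgroup.torsionBy A c).index ≠ 0}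
      zero_mem' := by
        have : AddSubgroup.torsionBy A 0 = ⊤ := by
          ext a; simp
        simp [this]
      add_mem' := by
        intro c c' hc hc'
        refine fun h => AddSubgroup.index_inf_ne_zero hc hc' ?_
        refine index_eq_zero_of_le ?_ h
        rintro a ⟨h1, h2⟩
        have h1 : c • a = 0 := mem_torsionBy.1 h1
        have h2 : c' • a = 0 := mem_torsionBy.1 h2
        rw [mem_torsionBy, add_smul, h1, h2, add_zero]
      neg_mem' := by
        intro c hc
        have : AddSubgroup.torsionBy A (-c) = AddSubgroup.torsionBy A c := by
          ext a; simp
        simpa [this] using hc }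
  obtain ⟨n, hn⟩ := Int.subgroup_cyclic I
  refine ⟨n, fun c => ?_⟩
  change c ∈ I ↔ _
  rw [hn, ← AddSubgroup.zmultiples_eq_closure, Int.mem_zmultiples_iff]

/-- `p • A` does not contain `A[n]`, even up to a finite group, for a prime divisor `p` of the
essential exponent `n`. -/
theorem infinite_map_torsionBy {n m p : ℤ}
    (hn : ∀ c : ℤ, (AddSubgroup.torsionBy A c).index ≠ 0 ↔ n ∣ c)
    (hm : n = p * m) (hnm : ¬ n ∣ m) :
    ((zsmulAddGroupHom m : A →+ A) '' (AddSubgroup.torsionBy A n)).Infinite := by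
  intro hfin
  -- If m • A[n] were finite, A[m] would have finite index in A[n], hence in A.
  refine hnm ((hn m).1 ?_)
  have hker : (zsmulAddGroupHom m : A →+ A).ker = AddSubgroup.torsionBy A m := by
    ext a; simp [AddMonoidHom.mem_ker]
  have h1 : (AddSubgroup.torsionBy A m).relIndex (AddSubgroup.torsionBy A n) ≠ 0 := by
    rw [← hker, AddSubgroup.relIndex_ker]
    have : Finite ((AddSubgroup.torsionBy A n).map (zsmulAddGroupHom m : A →+ A)) := hfin
    exact Nat.card_pos.ne'
  have h2 := AddSubgroup.relIndex_mul_index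
    (torsionBy_le_of_dvd (A := A) (Dvd.intro_left p hm.symm))
  rw [← h2]
  exact mul_ne_zero h1 ((hn n).2 dvd_rfl)

theorem finite_range_zsmul {n : ℤ} (hn : (AddSubgroup.torsionBy A n).index ≠ 0) :
    (Set.range fun a : A => n • a).Finite := by
  have hker : (zsmulAddGroupHom n : A →+ A).ker = AddSubgroup.torsionBy A n := by
    ext a; simp [AddMonoidHom.mem_ker]
  rw [← hker, AddSubgroup.index_ker] at hn
  exact (Nat.finite_of_card_ne_zero hn : Finite (zsmulAddGroupHom n : A →+ A).range)

/-- Take D = S ∩ A[n], which has finite index in A; if A[c] had finite index in D it would have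
finite index in A, forcing n ∣ c. -/
theorem exists_metrizable_not_isClosed_of_index_ne_zero [Countable A] {n : ℤ}
    (hn : ∀ c : ℤ, (AddSubgroup.torsionBy A c).index ≠ 0 ↔ n ∣ c) {S : AddSubgroup A}
    (hS : S.index ≠ 0) {x : A} (hx : n • x = 0) (hxS : x ∉ S) :
    ∃ _ : TopologicalSpace A, IsTopologicalAddGroup A ∧ TopologicalSpace.MetrizableSpace A ∧
      ¬ IsClosed (S : Set A) := by
  have hD : (S ⊓ AddSubgroup.torsionBy A n).index ≠ 0 :=
    AddSubgroup.index_inf_ne_zero hS ((hn n).2 dvd_rfl)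
  refine exists_metrizable_not_isClosed (D := S ⊓ AddSubgroup.torsionBy A n) (n := n)
    inf_le_left hxS (fun d hd => mem_torsionBy.1 hd.2) hx fun c hc => ?_
  by_contra hne
  refine hc ((hn c).1 fun h0 => ?_)
  rw [← AddSubgroup.relIndex_top_right] at hD h0
  exact AddSubgroup.relIndex_ne_zero_trans hne hD h0

/-- A transvection `1 + r` moving `x`. -/
theorem exists_transvection {e x : A} (he : e ≠ 0) (h2e : (2 : ℤ) • e = 0)
    (hx : ∀ (y : A) (k : ℤ), x ≠ (2 : ℤ) • y + k • e) :
    ∃ r : A →+ A, (∀ a, r (r a) + (2 : ℤ) • r a = 0) ∧ r.ker.index ≠ 0 ∧ r x ≠ 0 := by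
  -- The map is r a = φ(a)e with φ : A → ℤ/2 killing K and φ(x) ≠ 0. Then r² = 0 because φ(e) = 0,
  -- and 2r = 0 because 2e = 0.
  let K : AddSubgroup A := (zsmulAddGroupHom 2 : A →+ A).range ⊔ AddSubgroup.zmultiples e
  have h2K : ∀ a : A, 2 • a ∈ K := fun a =>
    (le_sup_left : _ ≤ K) ⟨a, ofNat_zsmul a 2⟩
  let : Module (ZMod 2) (A ⧸ K) := QuotientAddGroup.zmodModule h2K
  have hxK : (QuotientAddGroup.mk x : A ⧸ K) ≠ 0 := by
    intro h
    rw [QuotientAddGroup.eq_zero_iff] at h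
    obtain ⟨_, ⟨y, rfl⟩, _, ⟨k, rfl⟩, h⟩ := AddSubgroup.mem_sup.1 h
    exact hx y k h.symm
  obtain ⟨f, hf⟩ : ∃ f : Module.Dual (ZMod 2) (A ⧸ K), f (QuotientAddGroup.mk x) ≠ 0 := by
    by_contra! h
    exact hxK ((Module.forall_dual_apply_eq_zero_iff (ZMod 2) _).1 h)
  let g : ZMod 2 →+ A := ZMod.lift 2 ⟨zmultiplesHom A e, by simpa using h2e⟩
  let φ : A →+ ZMod 2 := f.toAddMonoidHom.comp (QuotientAddGroup.mk' K)
  have hφe : φ e = 0 := by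
    have : (QuotientAddGroup.mk e : A ⧸ K) = 0 :=
      (QuotientAddGroup.eq_zero_iff e).2
        ((le_sup_right : _ ≤ K) (AddSubgroup.mem_zmultiples e))
    change f (QuotientAddGroup.mk e) = 0
    rw [this, map_zero]
  have hg1 : g 1 = e := by
    have := ZMod.lift_coe 2 (⟨zmultiplesHom A e, by simpa using h2e⟩ :
      {f : ℤ →+ A // f (2 : ℕ) = 0}) 1
    simpa using this
  have hg : ∀ u : ZMod 2, u = 0 ∧ g u = 0 ∨ u = 1 ∧ g u = e := by
    intro u
    obtain rfl | rfl : u = 0 ∨ u = 1 := by revert u; decide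
    · exact Or.inl ⟨rfl, map_zero g⟩
    · exact Or.inr ⟨rfl, hg1⟩
  refine ⟨g.comp φ, fun a => ?_, ?_, ?_⟩
  · change g (φ (g (φ a))) + (2 : ℤ) • g (φ a) = 0
    rcases hg (φ a) with ⟨_, h⟩ | ⟨_, h⟩ <;> simp [h, hφe, h2e]
  · rw [AddSubgroup.index_ker]
    have : Finite (g.comp φ).range := by
      refine Set.Finite.subset (Set.finite_range g) ?_
      rintro _ ⟨a, rfl⟩
      exact ⟨φ a, rfl⟩
    exact Nat.card_pos.ne'
  · rcases hg (φ x) with ⟨h, _⟩ | ⟨_, h⟩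
    · exact absurd h hf
    · change g (φ x) ≠ 0
      rwa [h]

/-- An element of order `m` of `ℚ / ℤ` generates the `m`-torsion. -/
theorem addCircle_mem_zmultiples {m : ℕ} (hm : 0 < m) {u v : AddCircle (1 : ℚ)}
    (hv : addOrderOf v = m) (hu : m • u = 0) : u ∈ AddSubgroup.zmultiples v := by
  have hfin := AddCircle.finite_torsion (1 : ℚ) hm
  have hcard : {u : AddCircle (1 : ℚ) | m • u = 0}.ncard ≤ m := by
    have := AddCircle.card_torsion_le_of_isSMulRegular (1 : ℚ) m hm.ne'
      (.of_right_eq_zero_of_smul fun _ ↦ by simp [hm.ne'])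
    rw [← hfin.cast_ncard_eq] at this
    exact_mod_cast this
  have hsub : (AddSubgroup.zmultiples v : Set (AddCircle (1 : ℚ))) ⊆ {u | m • u = 0} := by
    rintro _ ⟨k, rfl⟩
    have : m • v = 0 := hv ▸ addOrderOf_nsmul_eq_zero v
    simp only [Set.mem_ofPred_eq]
    rw [smul_comm, this, smul_zero]
  have hcard' : (AddSubgroup.zmultiples v : Set (AddCircle (1 : ℚ))).ncard = m := by
    rw [← hv, ← Nat.card_zmultiples]
    rfl
  have := Set.eq_of_subset_of_ncard_le hsub (hcard.trans hcard'.ge) hfin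
  exact this.ge hu

/-- An element `y` of order `p ^ (k + 1)` with `p ^ k • y` not divisible by `p ^ (k + 1)` generates
a direct summand. -/
theorem exists_projection_zmultiples {p k : ℕ} (hp : p.Prime) {y : A}
    (hy : p ^ (k + 1) • y = 0) (hdiv : ∀ z : A, p ^ k • y ≠ p ^ (k + 1) • z) :
    ∃ π : A →+ A, (∀ a, π (π a) = π a) ∧ π.ker.index ≠ 0 ∧ π y = y := by
  have hpos : 0 < p ^ (k + 1) := pow_pos hp.pos _
  -- A character of A/K that is nonzero at p^k y is injective on ⟨y⟩ and maps it onto the whole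
  -- p^(k+1)-torsion of ℚ/ℤ. Inverting it there gives a retraction of A onto ⟨y⟩.
  let K : AddSubgroup A := (nsmulAddMonoidHom (p ^ (k + 1)) : A →+ A).range
  have hne : (QuotientAddGroup.mk (p ^ k • y) : A ⧸ K) ≠ 0 := by
    rw [Ne, QuotientAddGroup.eq_zero_iff]
    rintro ⟨z, hz⟩
    exact hdiv z hz.symm
  obtain ⟨c, hc⟩ := CharacterModule.exists_character_apply_ne_zero_of_ne_zero hne
  let χ : A →+ AddCircle (1 : ℚ) := AddMonoidHom.comp c (QuotientAddGroup.mk' K)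
  have hχy : p ^ k • χ y ≠ 0 := by
    rw [← map_nsmul]
    exact hc
  have hχ : ∀ a, p ^ (k + 1) • χ a = 0 := by
    intro a
    rw [← map_nsmul]
    have : (QuotientAddGroup.mk (p ^ (k + 1) • a) : A ⧸ K) = 0 :=
      (QuotientAddGroup.eq_zero_iff _).2 ⟨a, rfl⟩
    change c (QuotientAddGroup.mk (p ^ (k + 1) • a)) = 0
    rw [this, map_zero]
  have : Fact p.Prime := ⟨hp⟩
  have hord : addOrderOf (χ y) = p ^ (k + 1) := addOrderOf_eq_prime_pow hχy (hχ y)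
  have hordy : addOrderOf y = p ^ (k + 1) := by
    refine addOrderOf_eq_prime_pow (fun h => hχy ?_) hy
    rw [← map_nsmul, h, map_zero]
  let ι : AddSubgroup.zmultiples y →+ AddCircle (1 : ℚ) :=
    χ.comp (AddSubgroup.zmultiples y).subtype
  have hι : Function.Injective ι := by
    rw [injective_iff_map_eq_zero]
    rintro ⟨_, j, rfl⟩ h
    have h : χ (j • y) = 0 := h
    rw [map_zsmul, ← addOrderOf_dvd_iff_zsmul_eq_zero, hord, ← hordy,
      addOrderOf_dvd_iff_zsmul_eq_zero] at h
    exact Subtype.ext h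
  have hrange : ∀ a, χ a ∈ ι.range := by
    intro a
    obtain ⟨j, hj⟩ := addCircle_mem_zmultiples hpos hord (hχ a)
    refine ⟨⟨j • y, j, rfl⟩, ?_⟩
    change χ (j • y) = χ a
    rw [map_zsmul]
    exact hj
  let ρ : A →+ AddSubgroup.zmultiples y :=
    (AddMonoidHom.ofInjective hι).symm.toAddMonoidHom.comp (χ.codRestrict ι.range hrange)
  have hρ : ∀ a, ι (ρ a) = χ a := by
    intro a
    have := (AddMonoidHom.ofInjective hι).apply_symm_apply (χ.codRestrict ι.range hrange a)
    exact congrArg Subtype.val this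
  have hρs : ∀ z : AddSubgroup.zmultiples y, ρ z = z := fun z => hι (hρ z)
  refine ⟨(AddSubgroup.zmultiples y).subtype.comp ρ, fun a => ?_, ?_, ?_⟩
  · exact congrArg Subtype.val (hρs (ρ a))
  · rw [AddSubgroup.index_ker]
    have hfin : Finite (AddSubgroup.zmultiples y) := by
      rw [← Nat.card_pos_iff.trans (and_iff_right ⟨0⟩), Nat.card_zmultiples, hordy]
      exact hpos
    have : Finite ((AddSubgroup.zmultiples y).subtype.comp ρ).range := by
      refine Set.Finite.subset (Set.toFinite (AddSubgroup.zmultiples y : Set A)) ?_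
      rintro _ ⟨a, rfl⟩
      exact (ρ a).2
    exact Nat.card_pos.ne'
  · exact congrArg Subtype.val (hρs ⟨y, AddSubgroup.mem_zmultiples y⟩)

/-- If the essential exponent is divisible by a prime `p`, some cyclic `p`-group of order dividing
it is a direct summand. -/
theorem exists_primary_generator {n : ℤ} {p : ℕ} (hp : p.Prime) (hn0 : n ≠ 0) (hpn : (p : ℤ) ∣ n)
    (hn : ∀ c : ℤ, (AddSubgroup.torsionBy A c).index ≠ 0 ↔ n ∣ c) :
    ∃ (y : A) (k : ℕ), n • y = 0 ∧ p ^ (k + 1) • y = 0 ∧ ∀ z : A, p ^ k • y ≠ p ^ (k + 1) • z := by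
  have hpp : Prime (p : ℤ) := Nat.prime_iff_prime_int.1 hp
  have hfinm : FiniteMultiplicity (p : ℤ) n :=
    FiniteMultiplicity.of_prime_left hpp hn0
  obtain ⟨q, hq, hpq⟩ := hfinm.exists_eq_pow_mul_and_not_dvd
  obtain ⟨k, hk⟩ : ∃ k, multiplicity (p : ℤ) n = k + 1 := by
    refine Nat.exists_eq_succ_of_ne_zero fun h => ?_
    rw [h, pow_zero, one_mul] at hq
    exact hpq (hq ▸ hpn)
  rw [hk] at hq
  let m : ℤ := p ^ k * q
  have hnm : n = p * m := by rw [hq]; ring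
  have hm0 : m ≠ 0 := by rintro h; exact hn0 (by rw [hnm, h, mul_zero])
  have hndvd : ¬ n ∣ m := by
    rintro ⟨j, hj⟩
    rw [hnm] at hj
    have : (p : ℤ) * j = 1 := by
      apply mul_left_cancel₀ hm0
      linear_combination -hj
    exact hpp.not_isUnit (IsUnit.of_mul_eq_one _ this)
  -- Here m = n/p, so m • A[n] is infinite while nA is finite: some z ∈ A[n] has mz ∉ nA. The
  -- generator is y = qz, q being the prime-to-p part of n.
  obtain ⟨_, ⟨z, hz, rfl⟩, hz'⟩ :=
    (infinite_map_torsionBy hn hnm hndvd).exists_notMem_finite (finite_range_zsmul ((hn n).2 dvd_rfl))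
  have hz : n • z = 0 := mem_torsionBy.1 hz
  have hz' : ∀ w : A, n • w ≠ m • z := fun w h => hz' ⟨w, h⟩
  have hcop : IsCoprime (p : ℤ) q := (hpp.coprime_iff_not_dvd).2 hpq
  obtain ⟨a, b, hab⟩ := hcop
  refine ⟨q • z, k, ?_, ?_, fun w hw => ?_⟩
  · rw [smul_comm, hz, smul_zero]
  · rw [← natCast_zsmul, smul_smul]
    push_cast
    rw [← hq, hz]
  · rw [← natCast_zsmul, ← natCast_zsmul, smul_smul] at hw
    push_cast at hw
    -- With ap + bq = 1, an equation p^k y = p^(k+1) w would give mz = n(bw).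
    refine hz' (b • w) ?_
    calc n • b • w = (b * q) • ((p : ℤ) ^ (k + 1)) • w := by
            rw [smul_smul, smul_smul, hq]; congr 1; ring
      _ = (b * q) • m • z := by rw [← hw]
      _ = m • z - a • n • z := by
            rw [smul_smul, smul_smul, ← sub_smul, hnm]; congr 1; linear_combination m * hab
      _ = m • z := by rw [hz, smul_zero, sub_zero]

/-- The involution 1 - 2π inverts the image of π and fixes its kernel. -/
theorem neg_two_projection (π : A →+ A) (hπ : ∀ a, π (π a) = π a) (a : A) :
    ((-2 : ℤ) • π) (((-2 : ℤ) • π) a) + (2 : ℤ) • ((-2 : ℤ) • π) a = 0 := by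
  simp only [AddMonoidHom.smul_apply, map_zsmul, hπ]
  module

theorem index_ker_zsmul_ne_zero {π : A →+ A} (h : π.ker.index ≠ 0) (c : ℤ) :
    (c • π).ker.index ≠ 0 := by
  refine fun h0 => h (index_eq_zero_of_le ?_ h0)
  intro a ha
  rw [AddMonoidHom.mem_ker] at ha ⊢
  simp [ha]

/-- An even nonzero essential exponent provides the data of a transvection. -/
theorem exists_transvection_data {n : ℤ} (hn0 : n ≠ 0) (h2n : (2 : ℤ) ∣ n)
    (hn : ∀ c : ℤ, (AddSubgroup.torsionBy A c).index ≠ 0 ↔ n ∣ c) :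
    ∃ e x : A, e ≠ 0 ∧ (2 : ℤ) • e = 0 ∧ n • x = 0 ∧
      ∀ (y : A) (k : ℤ), x ≠ (2 : ℤ) • y + k • e := by
  obtain ⟨m, hm⟩ := h2n
  have hndvd : ¬ n ∣ m := by
    rintro ⟨j, hj⟩
    have : m * (2 * j) = m * 1 := by rw [hm] at hj; linear_combination -hj
    have := mul_left_cancel₀ (by rintro rfl; exact hn0 hm) this
    omega
  have hinf := infinite_map_torsionBy hn hm hndvd
  obtain ⟨_, ⟨w, hw, rfl⟩, hw'⟩ := hinf.exists_notMem_finite (Set.finite_singleton (0 : A))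
  have hw : n • w = 0 := mem_torsionBy.1 hw
  let e := m • w
  have h2e : (2 : ℤ) • e = 0 := by rw [smul_smul, ← hm, hw]
  -- As n = 2m, multiplying x = 2y + ke by m puts mx into the finite set nA + {0, me}; x is chosen
  -- in A[n] with mx outside it.
  have hfin := (finite_range_zsmul ((hn n).2 dvd_rfl)).add
    ((Set.finite_range fun b : Bool => if b then m • e else 0))
  obtain ⟨_, ⟨x, hx, rfl⟩, hx'⟩ := hinf.exists_notMem_finite hfin
  refine ⟨e, x, hw', h2e, mem_torsionBy.1 hx, ?_⟩
  rintro y k rfl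
  refine hx' ⟨n • y, ⟨y, rfl⟩, ?_⟩
  rcases Int.even_or_odd' k with ⟨j, rfl | rfl⟩
  · refine ⟨0, ⟨false, rfl⟩, ?_⟩
    have : (2 * j) • e = 0 := by rw [mul_comm, mul_smul, h2e, smul_zero]
    simp [this, hm, mul_comm 2 m, mul_smul]
  · refine ⟨m • e, ⟨true, rfl⟩, ?_⟩
    have : (2 * j + 1) • e = e := by
      rw [add_smul, mul_comm, mul_smul, h2e, smul_zero, zero_add, one_smul]
    simp [this, hm, mul_comm 2 m, mul_smul]

/-- In an infinite summand of exponent 2 take e ≠ 0 and x outside {0, e}; projecting x = 2y + ke to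
the summand leaves x = ke. -/
theorem exists_transvection_data_of_two_smul {π : A →+ A} (hπ : ∀ a, π (π a) = π a)
    (hinf : (Set.range π).Infinite) (h2 : ∀ a, (2 : ℤ) • π a = 0) :
    ∃ e x : A, e ≠ 0 ∧ (2 : ℤ) • e = 0 ∧ ∀ (y : A) (k : ℤ), x ≠ (2 : ℤ) • y + k • e := by
  obtain ⟨_, ⟨a, rfl⟩, ha⟩ := hinf.exists_notMem_finite (Set.finite_singleton (0 : A))
  obtain ⟨_, ⟨b, rfl⟩, hb⟩ := hinf.exists_notMem_finite (Set.toFinite {0, π a})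
  refine ⟨π a, π b, ha, h2 a, fun y k h => hb ?_⟩
  have h : π b = k • π a := by
    have := congrArg π h
    rwa [map_add, map_zsmul, map_zsmul, hπ, hπ, h2, zero_add] at this
  rw [h]
  rcases Int.even_or_odd' k with ⟨j, rfl | rfl⟩
  · left
    rw [mul_comm, mul_smul, h2, smul_zero]
  · right
    rw [Set.mem_singleton_iff, add_smul, mul_comm, mul_smul, h2, smul_zero, zero_add, one_smul]

/-- The complement (1 - π)A is fixed by 1 - 2π and serves as D; with n = 0 the limit x carries no
torsion condition. -/
theorem exists_metrizable_inversion [Countable A] {π : A →+ A} (hπ : ∀ a, π (π a) = π a)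
    (h2 : ∃ a, (2 : ℤ) • π a ≠ 0)
    (hind : ∀ c : ℤ, c ≠ 0 →
      (AddSubgroup.torsionBy A c).relIndex (AddMonoidHom.id A - π).range = 0) :
    ∃ _ : TopologicalSpace A, IsTopologicalAddGroup A ∧ TopologicalSpace.MetrizableSpace A ∧
      ¬ IsClosed (((-2 : ℤ) • π).ker : Set A) := by
  obtain ⟨a, ha⟩ := h2
  refine exists_metrizable_not_isClosed (D := (AddMonoidHom.id A - π).range) (n := 0) (x := a)
    ?_ ?_ (fun _ _ => zero_smul _ _) (zero_smul _ _) fun c hc => hind c ?_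
  · rintro _ ⟨b, rfl⟩
    simp [AddMonoidHom.mem_ker, hπ]
  · simpa [AddMonoidHom.mem_ker] using ha
  · rintro rfl
    exact hc dvd_rfl

/-- A countable abelian group with a decomposition into two infinite summands has an involutory
automorphism `1 + r` whose fixed points are not closed in some metrizable group topology. -/
theorem exists_involution_not_isClosed_fixed [Countable A] {π : A →+ A}
    (hπ : ∀ a, π (π a) = π a) (h1 : (Set.range π).Infinite)
    (h2 : (Set.range (AddMonoidHom.id A - π)).Infinite) :
    ∃ r : A →+ A, (∀ a, r (r a) + (2 : ℤ) • r a = 0) ∧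
      ∃ _ : TopologicalSpace A, IsTopologicalAddGroup A ∧ TopologicalSpace.MetrizableSpace A ∧
        ¬ IsClosed (r.ker : Set A) := by
  obtain ⟨n, hn⟩ := exists_essential_exponent A
  have htrans : (∃ e x : A, e ≠ 0 ∧ (2 : ℤ) • e = 0 ∧ n • x = 0 ∧
      ∀ (y : A) (k : ℤ), x ≠ (2 : ℤ) • y + k • e) →
      ∃ r : A →+ A, (∀ a, r (r a) + (2 : ℤ) • r a = 0) ∧
        ∃ _ : TopologicalSpace A, IsTopologicalAddGroup A ∧ TopologicalSpace.MetrizableSpace A ∧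
          ¬ IsClosed (r.ker : Set A) := by
    rintro ⟨e, x, he, h2e, hx, hxe⟩
    obtain ⟨r, hr, hri, hrx⟩ := exists_transvection he h2e hxe
    exact ⟨r, hr, exists_metrizable_not_isClosed_of_index_ne_zero hn hri hx hrx⟩
  rcases eq_or_ne n 0 with rfl | hn0
  · have hπ' : ∀ a, (AddMonoidHom.id A - π) ((AddMonoidHom.id A - π) a) =
        (AddMonoidHom.id A - π) a := by simp [hπ]
    by_cases h3 : ∀ a, (2 : ℤ) • π a = 0
    · obtain ⟨e, x, he, h2e, hx⟩ := exists_transvection_data_of_two_smul hπ h1 h3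
      exact htrans ⟨e, x, he, h2e, zero_smul _ _, hx⟩
    by_cases h4 : ∀ a, (2 : ℤ) • (AddMonoidHom.id A - π) a = 0
    · obtain ⟨e, x, he, h2e, hx⟩ := exists_transvection_data_of_two_smul hπ' h2 h4
      exact htrans ⟨e, x, he, h2e, zero_smul _ _, hx⟩
    push Not at h3 h4
    by_cases h5 : ∀ c : ℤ, c ≠ 0 →
        (AddSubgroup.torsionBy A c).relIndex (AddMonoidHom.id A - π).range = 0
    · exact ⟨_, neg_two_projection π hπ, exists_metrizable_inversion hπ h3 h5⟩
    refine ⟨_, neg_two_projection _ hπ', exists_metrizable_inversion hπ' h4 fun c hc => ?_⟩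
    rw [sub_sub_cancel]
    by_contra h6
    push Not at h5
    obtain ⟨c', hc', h5⟩ := h5
    rw [← AddSubgroup.index_comap] at h5 h6
    -- If neither summand could serve as D, A[cc'] would have finite index with cc' ≠ 0, against n =
    -- 0.
    have h7 : (AddSubgroup.torsionBy A (c * c')).index ≠ 0 := fun h0 =>
      AddSubgroup.index_inf_ne_zero h6 h5
        (index_eq_zero_of_le (torsionBy_mul_ge_comap π c c') h0)
    exact mul_ne_zero hc hc' (zero_dvd_iff.1 ((hn _).1 h7))
  by_cases h2n : (2 : ℤ) ∣ n
  · exact htrans (exists_transvection_data hn0 h2n hn)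
  -- Essential exponent ±1 would make A = 1 • A finite.
  have hn1 : n.natAbs ≠ 1 := by
    intro h
    have h1n : (AddSubgroup.torsionBy A 1).index ≠ 0 :=
      (hn 1).2 (Int.isUnit_iff_natAbs_eq.2 h).dvd
    have := finite_range_zsmul h1n
    refine h1 (this.subset ?_)
    rintro _ ⟨a, rfl⟩
    exact ⟨π a, one_smul _ _⟩
  obtain ⟨p, hp, hpn⟩ := Nat.exists_prime_and_dvd hn1
  rw [← Int.natCast_dvd] at hpn
  obtain ⟨y, k, hny, hpy, hdiv⟩ := exists_primary_generator hp hn0 hpn hn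
  obtain ⟨ρ, hρ, hind, hρy⟩ := exists_projection_zmultiples hp hpy hdiv
  refine ⟨_, neg_two_projection ρ hρ,
    exists_metrizable_not_isClosed_of_index_ne_zero hn (index_ker_zsmul_ne_zero hind _) hny ?_⟩
  -- The point y is moved by inversion: n is odd, so ny = 0 and 2y = 0 would give y = 0.
  intro h2y
  have h2y : (2 : ℤ) • y = 0 := by simpa [AddMonoidHom.mem_ker, hρy] using h2y
  obtain ⟨j, hj⟩ : Odd n := by rwa [← Int.not_even_iff_odd, even_iff_two_dvd]
  have hy0 : y = 0 := by
    rwa [hj, add_smul, mul_comm, mul_smul, h2y, smul_zero, zero_add, one_smul] at hny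
  exact hdiv 0 (by simp [hy0])

end Involution

/-! ### Centralizers as an obstruction to embedding and extension. -/

section Embedding

variable {G : Type*} [Group G]

theorem isClosed_of_isElementaryAlgebraic {t : TopologicalSpace G}
    (ht : IsHausdorffGroupTopology t) {S : Set G} (hS : IsElementaryAlgebraic S) :
    IsClosed[t] S := by
  obtain ⟨_, _⟩ := ht
  obtain ⟨m, a, ε, rfl⟩ := hS
  refine isClosed_eq ?_ continuous_const
  refine Continuous.mul ?_ (continuous_zpow _)
  simp_rw [List.ofFn_eq_map]
  exact continuous_list_prod _ fun i _ => (continuous_zpow _).mul continuous_const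

theorem le_zariskiTopology {t : TopologicalSpace G} (ht : IsHausdorffGroupTopology t) :
    t ≤ zariskiTopology G := by
  refine le_generateFrom fun U hU => ?_
  have h := isClosed_of_isElementaryAlgebraic ht hU
  rwa [← @isOpen_compl_iff, compl_compl] at h

theorem isClosed_zariskiTopology {S : Set G} (hS : IsElementaryAlgebraic S) :
    IsClosed[zariskiTopology G] S := by
  rw [← @isOpen_compl_iff]
  refine TopologicalSpace.isOpen_generateFrom_of_mem ?_
  rwa [Set.mem_ofPred_eq, compl_compl]

theorem isElementaryAlgebraic_centralizer (h : G) :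
    IsElementaryAlgebraic {y : G | y * h * y⁻¹ = h} :=
  ⟨1, fun _ => h, ![1, -1], by ext; simp⟩

variable {K : Subgroup G} {h : G} {t : TopologicalSpace K}

/-- If the centralizer of `h` in `K` is not closed in a Hausdorff group topology on `K`, then `K`
is neither Markov nor Zariski embedded and the topology does not extend. -/
theorem not_embedded_of_not_isClosed (ht : IsHausdorffGroupTopology t)
    (hcl : ¬ IsClosed[t] {k : K | (k : G) * h * (k : G)⁻¹ = h}) :
    ¬ MarkovEmbedded K ∧ ¬ ZariskiEmbedded K ∧
      ∀ s : TopologicalSpace G, IsHausdorffGroupTopology s → ¬ ExtendsTopology K s t := by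
  have hC := isElementaryAlgebraic_centralizer h
  -- Each of the three properties would make t finer than or equal to the trace of a topology in
  -- which the centralizer is closed.
  have hind : ∀ s : TopologicalSpace G, IsClosed[s] {y : G | y * h * y⁻¹ = h} →
      t ≤ s.induced ((↑) : K → G) → False := fun s hs hts =>
    hcl ((isClosed_induced_iff.2 ⟨_, hs, rfl⟩ : IsClosed[s.induced ((↑) : K → G)] _).mono hts)
  refine ⟨fun hM => ?_, fun hZ => ?_, fun s hs hst => ?_⟩
  · refine hind (markovTopology G) ?_ (hM ▸ le_sSup ht)
    exact isClosed_sSup_iff.2 fun s hs => isClosed_of_isElementaryAlgebraic hs hC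
  · exact hind (zariskiTopology G) (isClosed_zariskiTopology hC) (hZ ▸ le_zariskiTopology ht)
  · exact hind s (isClosed_of_isElementaryAlgebraic hs hC) hst.ge

end Embedding

/-! ### The extension N ⋊ ⟨σ⟩ realized as a graph. -/

section Graph

variable {N : Type*} [CommGroup N]

/-- The semidirect product of `N` with the group generated by an automorphism. -/
abbrev CyclicExtension (σ : MulAut N) : Type _ :=
  N ⋊[(Subgroup.zpowers σ).subtype] (Subgroup.zpowers σ)

/-- The graph in `L × L` of the retraction of `L = N ⋊ ⟨σ⟩` onto `⟨σ⟩`. -/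
def graphHom (σ : MulAut N) : CyclicExtension σ →* CyclicExtension σ × CyclicExtension σ :=
  (MonoidHom.id _).prod (SemidirectProduct.inr.comp SemidirectProduct.rightHom)

theorem graphHom_injective (σ : MulAut N) : Function.Injective (graphHom σ) :=
  fun _ _ h => congrArg Prod.fst h

/-- The isomorphism of `N ⋊ ⟨σ⟩` with its graph. -/
noncomputable def graphEquiv (σ : MulAut N) : CyclicExtension σ ≃* (graphHom σ).range :=
  MonoidHom.ofInjective (graphHom_injective σ)

theorem graphEquiv_mem_firstFactorPart (σ : MulAut N) (l : CyclicExtension σ) :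
    graphEquiv σ l ∈ firstFactorPart (graphHom σ).range ↔ l.right = 1 := by
  change graphHom σ l ∈ (⊤ : Subgroup _).prod ⊥ ↔ _
  rw [Subgroup.mem_prod, Subgroup.mem_bot]
  change _ ∧ SemidirectProduct.inr l.right = _ ↔ _
  rw [map_eq_one_iff _ SemidirectProduct.inr_injective]
  simp

theorem firstFactorPart_graph_index (σ : MulAut N) :
    (firstFactorPart (graphHom σ).range).index = orderOf σ := by
  have h : (firstFactorPart (graphHom σ).range).comap (graphEquiv σ).toMonoidHom =
      (SemidirectProduct.rightHom : CyclicExtension σ →* _).ker := by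
    ext l
    exact graphEquiv_mem_firstFactorPart σ l
  rw [← Subgroup.index_comap_of_surjective _ (graphEquiv σ).surjective]
  change (Subgroup.comap (graphEquiv σ).toMonoidHom _).index = _
  rw [h, Subgroup.index_ker, MonoidHom.range_eq_top.2 SemidirectProduct.rightHom_surjective,
    Subgroup.card_top, Nat.card_zpowers]

/-- The kernel `N` of the retraction is the part of the graph in the first factor. -/
noncomputable def graphKernelEquiv (σ : MulAut N) : N ≃* firstFactorPart (graphHom σ).range :=
  MulEquiv.ofBijective
    (((graphEquiv σ).toMonoidHom.comp SemidirectProduct.inl).codRestrict _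
      fun n => (graphEquiv_mem_firstFactorPart σ _).2 rfl)
    (by
      constructor
      · intro a b hab
        exact SemidirectProduct.inl_injective ((graphEquiv σ).injective (congrArg Subtype.val hab))
      · rintro ⟨y, hy⟩
        obtain ⟨l, rfl⟩ := (graphEquiv σ).surjective y
        rw [graphEquiv_mem_firstFactorPart] at hy
        exact ⟨l.left, Subtype.ext (congrArg (graphEquiv σ)
          (SemidirectProduct.ext rfl hy.symm))⟩)

theorem coe_graphKernelEquiv (σ : MulAut N) (a : N) :
    (graphKernelEquiv σ a : (graphHom σ).range) = graphEquiv σ (SemidirectProduct.inl a) := rfl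

/-- Conjugation by σ in the semidirect product acts on N as σ, so the centralizer of σ meets N in
Fix σ. -/
theorem graphKernelEquiv_commute_iff (σ : MulAut N) (a : N) :
    (graphKernelEquiv σ a : (graphHom σ).range) *
        graphEquiv σ (SemidirectProduct.inr ⟨σ, Subgroup.mem_zpowers σ⟩) *
        (graphKernelEquiv σ a : (graphHom σ).range)⁻¹ =
      graphEquiv σ (SemidirectProduct.inr ⟨σ, Subgroup.mem_zpowers σ⟩) ↔ σ a = a := by
  rw [mul_inv_eq_iff_eq_mul, coe_graphKernelEquiv, ← map_mul, ← map_mul,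
    (graphEquiv σ).injective.eq_iff, SemidirectProduct.ext_iff]
  simp [eq_comm]

theorem IsMetricGroupTopology.isHausdorffGroupTopology {G : Type*} [Group G]
    {t : TopologicalSpace G} (ht : IsMetricGroupTopology t) : IsHausdorffGroupTopology t := by
  obtain ⟨h1, h2⟩ := ht
  exact ⟨h1, inferInstance⟩

theorem IsMetricGroupTopology.induced {G G' : Type*} [Group G] [Group G'] {t : TopologicalSpace G}
    (ht : IsMetricGroupTopology t) (e : G' ≃* G) : IsMetricGroupTopology (t.induced e) := by
  obtain ⟨_, _⟩ := ht
  let := t.induced e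
  exact ⟨topologicalGroup_induced e,
    (Topology.IsEmbedding.mk ⟨rfl⟩ e.injective).metrizableSpace⟩

/-- An involutory automorphism of `N` whose fixed points are not closed in some metric group
topology yields an index two extension of `N` with the required properties. -/
theorem exists_graph_of_involution {N : Type u} [CommGroup N] [Countable N] (σ : MulAut N)
    (hσ : σ ^ 2 = 1) {t : TopologicalSpace N} (ht : IsMetricGroupTopology t)
    (hcl : ¬ IsClosed {a | σ a = a}) :
    ∃ (G' : Type u) (_ : Group G') (H : Subgroup (G' × G'))
      (T : TopologicalSpace (firstFactorPart H)),
      Countable G' ∧ IsMetricGroupTopology T ∧ Nonempty (firstFactorPart H ≃* N) ∧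
      (firstFactorPart H).index = 2 ∧ ¬ MarkovEmbedded (firstFactorPart H) ∧
      ¬ ZariskiEmbedded (firstFactorPart H) ∧
      ∀ s : TopologicalSpace H, IsHausdorffGroupTopology s →
        ¬ ExtendsTopology (firstFactorPart H) s T := by
  have hne : σ ≠ 1 := by
    rintro rfl
    exact hcl (by simp)
  have hord : orderOf σ = 2 := orderOf_eq_prime hσ hne
  have hfin : Finite (Subgroup.zpowers σ) :=
    Nat.finite_of_card_ne_zero (by rw [Nat.card_zpowers, hord]; norm_num)
  have hT := ht.induced (graphKernelEquiv σ).symm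
  refine ⟨CyclicExtension σ, inferInstance, (graphHom σ).range, _,
    SemidirectProduct.equivProd.injective.countable, hT, ⟨(graphKernelEquiv σ).symm⟩,
    (firstFactorPart_graph_index σ).trans hord,
    not_embedded_of_not_isClosed
      (h := graphEquiv σ (SemidirectProduct.inr ⟨σ, Subgroup.mem_zpowers σ⟩))
      hT.isHausdorffGroupTopology fun h => hcl ?_⟩
  obtain ⟨C, hC, hCe⟩ := isClosed_induced_iff.1 h
  convert hC using 1
  ext a
  have h1 := Set.ext_iff.1 hCe (graphKernelEquiv σ a)
  rw [Set.mem_preimage, MulEquiv.symm_apply_apply] at h1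
  exact (graphKernelEquiv_commute_iff σ a).symm.trans h1.symm

end Graph

/-! ### From the decomposition to an involution, and the conclusion. -/

/-- The automorphism `1 + r` of an abelian group, for an endomorphism `r` with `r² + 2r = 0`. -/
def involutionOf {A : Type*} [AddCommGroup A] (r : A →+ A)
    (hr : ∀ a, r (r a) + (2 : ℤ) • r a = 0) : A ≃+ A :=
  have h : Function.Involutive (AddMonoidHom.id A + r) := fun a => by
    have := hr a
    simp only [AddMonoidHom.add_apply, AddMonoidHom.id_apply, map_add]
    rw [two_smul] at this
    calc a + r a + (r a + r (r a)) = a + (r (r a) + (r a + r a)) := by abel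
      _ = a := by rw [this, add_zero]
  { h.toPerm with map_add' := map_add (AddMonoidHom.id A + r) }

theorem exists_involution_of_mulEquiv_prod {N : Type*} [CommGroup N] [Countable N]
    {N₁ N₂ : Type*} [Group N₁] [Group N₂] [Infinite N₁] [Infinite N₂] (e : N ≃* N₁ × N₂) :
    ∃ (σ : MulAut N) (t : TopologicalSpace N), σ ^ 2 = 1 ∧ IsMetricGroupTopology t ∧
      ¬ IsClosed {a | σ a = a} := by
  let p : N →* N := e.symm.toMonoidHom.comp
    (((MonoidHom.inl N₁ N₂).comp (MonoidHom.fst N₁ N₂)).comp e.toMonoidHom)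
  have hp : ∀ a, p a = e.symm ((e a).1, 1) := fun _ => rfl
  let π : Additive N →+ Additive N := p.toAdditive
  have hπ : ∀ a, π (π a) = π a := fun a => by
    change p (p a) = p a
    rw [hp (p a), hp a, MulEquiv.apply_symm_apply]
  have h1 : (Set.range π).Infinite := by
    refine Set.infinite_of_injective_forall_mem
      (f := fun b : N₁ => Additive.ofMul (e.symm (b, 1))) (fun b b' h => ?_) fun b => ?_
    · exact congrArg Prod.fst (e.symm.injective h)
    · exact ⟨Additive.ofMul (e.symm (b, 1)), congrArg Additive.ofMul (by simp [hp])⟩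
  have h2 : (Set.range (AddMonoidHom.id (Additive N) - π)).Infinite := by
    refine Set.infinite_of_injective_forall_mem
      (f := fun b : N₂ => Additive.ofMul (e.symm (1, b))) (fun b b' h => ?_) fun b => ?_
    · exact congrArg Prod.snd (e.symm.injective h)
    · refine ⟨Additive.ofMul (e.symm (1, b)), sub_eq_self.2 ?_⟩
      change p (e.symm (1, b)) = 1
      rw [hp, MulEquiv.apply_symm_apply]
      exact map_one e.symm
  have : Countable (Additive N) := ‹Countable N›
  obtain ⟨r, hr, τ, hτ, hmet, hcl⟩ := exists_involution_not_isClosed_fixed hπ h1 h2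
  have hfix : {a : Additive N | involutionOf r hr a = a} = r.ker :=
    Set.ext fun a => add_eq_left (a := a)
  refine ⟨MulEquiv.toAdditive.symm (involutionOf r hr), τ, ?_, ⟨?_, hmet⟩, ?_⟩
  · refine MulEquiv.ext fun a => ?_
    exact (involutionOf r hr).left_inv a
  · exact @IsTopologicalGroup.mk N τ _ (@ContinuousMul.mk N τ _ hτ.continuous_add)
      (@ContinuousInv.mk N τ _ hτ.continuous_neg)
  · rw [← hfix] at hcl
    exact hcl

end MarkovZariski

theorem lemma2p11 {N : Type u} [CommGroup N] [Countable N]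
    {N₁ : Type v} {N₂ : Type w} [Group N₁] [Group N₂] [Infinite N₁] [Infinite N₂]
    (e : N ≃* N₁ × N₂) :
    ∃ (G' : Type u) (_ : Group G') (H : Subgroup (G' × G'))
      (T : TopologicalSpace (MarkovZariski.firstFactorPart H)),
      Countable G' ∧
      MarkovZariski.IsMetricGroupTopology T ∧
      Nonempty (MarkovZariski.firstFactorPart H ≃* N) ∧
      (MarkovZariski.firstFactorPart H).index = 2 ∧
      ¬ MarkovZariski.MarkovEmbedded (MarkovZariski.firstFactorPart H) ∧
      ¬ MarkovZariski.ZariskiEmbedded (MarkovZariski.firstFactorPart H) ∧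
      ∀ s : TopologicalSpace H, MarkovZariski.IsHausdorffGroupTopology s →
        ¬ MarkovZariski.ExtendsTopology (MarkovZariski.firstFactorPart H) s T := by
  obtain ⟨σ, _, hσ, ht, hcl⟩ := MarkovZariski.exists_involution_of_mulEquiv_prod e
  exact MarkovZariski.exists_graph_of_involution σ hσ ht hcl
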